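/- For a finite simple graph $G=(V,E)$ and a positive integer $k$, a $k$-list-assignment $L$ of $G$ assigns to every vertex $v$ a set $L(v)$ of exactly $k$ positive integers; a proper $L$-colouring of $G$ is a map $c$ on $V$ with $c(v)\in L(v)$ for every vertex $v$ and $c(u)\neq c(v)$ for every edge $uv$. The separation choosability $\mathrm{ch}_{\mathrm{sep}}(G)$ is the least positive integer $k$ such that $G$ has a proper $L$-colouring for every $k$-list-assignment $L$ that satisfies $|L(u)\cap L(v)|\le 1$ for every edge $uv$. Theorem. There is a constant $C>0$ such that, for every integer $d\ge 1$ and every finite simple bipartite graph $G$ of minimum degree $d$, $$\mathrm{ch}_{\mathrm{sep}}(G)\ \ge\ C\log d .$$ -/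

import Mathlib

namespace SepChoose

variable {V : Type*}

/-- `L` is a `k`-list-assignment: every vertex gets a list of exactly `k` colours,
the colours being positive integers. -/
def IsListAssignment (k : ℕ) (L : V → Finset ℕ+) : Prop :=
  ∀ v, (L v).card = k

/-- The lists of any two adjacent vertices share at most one colour. -/
def HasMaxSeparation (G : SimpleGraph V) (L : V → Finset ℕ+) : Prop :=
  ∀ u v, G.Adj u v → (L u ∩ L v).card ≤ 1

/-- There is a proper colouring of `G` in which every vertex gets a colour of its list. -/
def HasProperListColoring (G : SimpleGraph V) (L : V → Finset ℕ+) : Prop :=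
  ∃ c : G.Coloring ℕ+, ∀ v, c v ∈ L v

/-- `G` is separation `k`-choosable. -/
def SeparationChoosable (G : SimpleGraph V) (k : ℕ) : Prop :=
  ∀ L : V → Finset ℕ+, IsListAssignment k L → HasMaxSeparation G L →
    HasProperListColoring G L

/-- The separation choosability of `G`: the least positive integer `k` such that `G` is
separation `k`-choosable. For finite graphs such a `k` exists,
see `exists_separationChoosable`. -/
noncomputable def sepChoosability (G : SimpleGraph V) : ℕ :=
  sInf {k : ℕ | 0 < k ∧ SeparationChoosable G k}

/-- The infimum defining `sepChoosability` is attained for finite graphs. -/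
theorem exists_separationChoosable [Fintype V] (G : SimpleGraph V) :
    {k : ℕ | 0 < k ∧ SeparationChoosable G k}.Nonempty := by
  classical
  refine ⟨Fintype.card V + 1, Nat.succ_pos _, fun L hL _ => ?_⟩
  obtain ⟨f, hf, hfL⟩ :=
    (Finset.all_card_le_biUnion_card_iff_exists_injective L).1 (fun s => by
      rcases s.eq_empty_or_nonempty with rfl | ⟨v, hv⟩
      · simp
      · calc s.card ≤ (L v).card := by
              have := s.card_le_univ
              rw [hL v]
              omega
          _ ≤ (s.biUnion L).card :=
              Finset.card_le_card (Finset.subset_biUnion_of_mem L hv))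
  exact ⟨SimpleGraph.Coloring.mk f (fun h e => h.ne (hf e)), hfL⟩

end SepChoose

open Finset

namespace SepChoose

/-! Probabilistic method. Take `k * (2 * k)` colours in `k` blocks of `2 * k`. Vertices of the
smaller side `B` get random `k`-subsets of random blocks; those of `A` get one colour from each
block, so adjacent lists share at most one colour. Only a sparse random part `B'` of `B` is used, so
few colourings of it must be defeated, yet for `d` exponential in `k` half of `A` see every block
and subset on `B'` (`exists_labelling`). In any colouring of `B'`, such a vertex sees at least half
of each block, so a random list is blocked with probability at least `2⁻ᵏ`; choosing lists greedily
(`exists_choice_card_survivors_le`) defeats all colourings. -/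

/-! ### Averaging arguments -/

/-- The number of functions mapping `s` into `Q`, as a fraction of all functions. -/
theorem card_filter_forall_mem {V Λ : Type*} [Fintype V] [DecidableEq V] [Fintype Λ]
    [Nonempty Λ] [DecidableEq Λ] (s : Finset V) (Q : Finset Λ) :
    (#{φ : V → Λ | ∀ v ∈ s, φ v ∈ Q} : ℝ) =
      ((#Q : ℝ) / Fintype.card Λ) ^ #s * (Fintype.card (V → Λ) : ℝ) := by
  have h : ({φ : V → Λ | ∀ v ∈ s, φ v ∈ Q} : Finset (V → Λ)) =
      Fintype.piFinset fun v => if v ∈ s then Q else univ := by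
    ext φ
    simp only [mem_filter, mem_univ, true_and, Fintype.mem_piFinset]
    refine forall_congr' fun v => ?_
    by_cases hv : v ∈ s <;> simp [hv]
  have hΛ : (Fintype.card Λ : ℝ) ≠ 0 := by
    exact_mod_cast Fintype.card_ne_zero
  rw [h, Fintype.card_piFinset, Fintype.card_fun, ← card_univ (α := V)]
  push_cast
  have hs : ((#Q : ℝ) / Fintype.card Λ) ^ #s =
      ∏ v : V, if v ∈ s then (#Q : ℝ) / Fintype.card Λ else 1 := by
    rw [prod_ite_mem, univ_inter, prod_const]
  rw [hs, ← prod_const, ← prod_mul_distrib]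
  refine prod_congr rfl fun v _ => ?_
  by_cases hv : v ∈ s
  · simp only [hv, if_true]
    field_simp
  · simp [hv]

/-- Some labelling of `V` by `τ × σ` puts the second label `o` on few vertices of `B`, while most
vertices of `A` see each first label on some neighbour with second label `o`. -/
theorem exists_labelling {V τ σ : Type*} [Fintype V] [DecidableEq V] [Fintype τ] [DecidableEq τ]
    [Nonempty τ] [Fintype σ] [DecidableEq σ] (o : σ) (A B : Finset V) (hBA : #B ≤ #A)
    (nbr : V → Finset V) (d : ℕ) (hdeg : ∀ a ∈ A, d ≤ #(nbr a))
    (hd : 4 * Fintype.card τ ^ 2 * Fintype.card σ ≤ d) :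
    ∃ φ : V → τ × σ,
      (Fintype.card σ * #{b ∈ B | (φ b).2 = o} : ℝ) ≤ 2 * #A ∧
      (#A : ℝ) ≤ 2 * #{a ∈ A | ∀ t, ∃ b ∈ nbr a, φ b = (t, o)} := by
  have : Nonempty σ := ⟨o⟩
  set T := Fintype.card τ
  set N := Fintype.card σ
  have hT : 0 < (T : ℝ) := by exact_mod_cast Fintype.card_pos
  have hN : 0 < (N : ℝ) := by exact_mod_cast Fintype.card_pos
  set W : ℝ := (Fintype.card (V → τ × σ) : ℝ)
  have hM : (Fintype.card (τ × σ) : ℝ) = T * N := by rw [Fintype.card_prod]; push_cast; rfl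
  have hB : (∑ φ : V → τ × σ, (#{b ∈ B | (φ b).2 = o} : ℝ)) = #B * (W / N) := by
    simp only [card_filter, Nat.cast_sum]
    rw [sum_comm, ← nsmul_eq_mul, ← sum_const]
    refine sum_congr rfl fun b _ => ?_
    have := card_filter_forall_mem (V := V) {b} ((univ : Finset τ) ×ˢ {o})
    rw [hM, card_product] at this
    simp only [mem_singleton, forall_eq, mem_product, mem_univ, true_and, card_singleton,
      card_univ, mul_one, pow_one] at this
    rw [← Nat.cast_sum, ← card_filter, this]
    field_simp
    rfl
  have hmiss : ∀ a ∈ A, ∀ t : τ,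
      (#{φ : V → τ × σ | ∀ b ∈ nbr a, φ b ≠ (t, o)} : ℝ) ≤ W / (4 * T) := by
    intro a ha t
    have := card_filter_forall_mem (V := V) (nbr a) (univ.erase (t, o))
    simp only [mem_erase, mem_univ, and_true] at this
    rw [this, div_eq_mul_inv, mul_comm]
    refine mul_le_mul_of_nonneg_left ?_ (by positivity)
    have hc : (#(univ.erase (t, o)) : ℝ) / Fintype.card (τ × σ) ≤ Real.exp (-(1 / (T * N))) := by
      have h1 : (#(univ.erase (t, o)) : ℝ) = T * N - 1 := by
        rw [card_erase_of_mem (mem_univ _), card_univ, Nat.cast_sub Fintype.card_pos, hM]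
        simp
      rw [h1, hM, sub_div, div_self (by positivity)]
      linarith [Real.add_one_le_exp (-(1 / ((T : ℝ) * N)))]
    calc _ ≤ Real.exp (-(1 / (T * N))) ^ #(nbr a) := pow_le_pow_left₀ (by positivity) hc _
      _ = Real.exp (-(#(nbr a) / (T * N))) := by
        rw [← Real.exp_nat_mul]; congr 1; ring
      _ ≤ Real.exp (-(4 * T)) := by
        refine Real.exp_le_exp.2 (neg_le_neg ?_)
        rw [le_div_iff₀ (by positivity)]
        have : ((4 * T ^ 2 * N : ℕ) : ℝ) ≤ #(nbr a) := by exact_mod_cast hd.trans (hdeg a ha)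
        push_cast at this
        linarith
      _ ≤ (4 * (T : ℝ))⁻¹ := by
        rw [Real.exp_neg]
        exact inv_anti₀ (by positivity) (by linarith [Real.add_one_le_exp (4 * (T : ℝ))])
  have hbad : (∑ φ : V → τ × σ, (#{a ∈ A | ¬ ∀ t, ∃ b ∈ nbr a, φ b = (t, o)} : ℝ)) ≤
      #A * (W / 4) := by
    simp only [card_filter, Nat.cast_sum]
    rw [sum_comm, ← nsmul_eq_mul, ← sum_const]
    refine sum_le_sum fun a ha => ?_
    rw [← Nat.cast_sum, ← card_filter]
    have hsub : ({φ : V → τ × σ | ¬ ∀ t, ∃ b ∈ nbr a, φ b = (t, o)} : Finset _) ⊆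
        univ.biUnion fun t => {φ : V → τ × σ | ∀ b ∈ nbr a, φ b ≠ (t, o)} := by
      intro φ
      simp
    calc _ ≤ ((∑ t : τ, #{φ : V → τ × σ | ∀ b ∈ nbr a, φ b ≠ (t, o)} : ℕ) : ℝ) := by
          exact_mod_cast (card_le_card hsub).trans card_biUnion_le
      _ ≤ ∑ t : τ, W / (4 * T) := by
          push_cast
          exact sum_le_sum fun t _ => hmiss a ha t
      _ = W / 4 := by
          rw [sum_const, card_univ, nsmul_eq_mul]
          change (T : ℝ) * _ = _
          field_simp
  have hBA' : (#B : ℝ) ≤ #A := by exact_mod_cast hBA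
  -- The weight `N / 4` gives each term mean at most `#A / 4`, so a single `φ` meets both bounds.
  have hsum : (∑ φ : V → τ × σ, ((N / 4 : ℝ) * #{b ∈ B | (φ b).2 = o} +
      #{a ∈ A | ¬ ∀ t, ∃ b ∈ nbr a, φ b = (t, o)})) ≤ ∑ φ : V → τ × σ, (#A / 2 : ℝ) := by
    rw [sum_add_distrib, ← mul_sum, hB, sum_const, card_univ, nsmul_eq_mul]
    have : (N / 4 : ℝ) * (#B * (W / N)) = #B * (W / 4) := by field_simp
    rw [this]
    have : (#B : ℝ) * (W / 4) ≤ #A * (W / 4) := mul_le_mul_of_nonneg_right hBA' (by positivity)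
    change _ ≤ W * _
    linarith
  obtain ⟨φ, -, hφ⟩ := exists_le_of_sum_le univ_nonempty hsum
  have hsplit : (#{a ∈ A | ∀ t, ∃ b ∈ nbr a, φ b = (t, o)} : ℝ) +
      #{a ∈ A | ¬ ∀ t, ∃ b ∈ nbr a, φ b = (t, o)} = #A := by
    exact_mod_cast card_filter_add_card_filter_not _
  have h0 : 0 ≤ (N : ℝ) * #{b ∈ B | (φ b).2 = o} := by positivity
  have h1 : (0 : ℝ) ≤ #{a ∈ A | ¬ ∀ t, ∃ b ∈ nbr a, φ b = (t, o)} := by positivity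
  exact ⟨φ, by linarith, by linarith⟩

/-- If for each `a ∈ S` every `h ∈ H` is killed by a proportion at least `ε` of the choices
`x : X`, then suitable choices leave at most a proportion `(1 - ε) ^ #S` of `H`. -/
theorem exists_choice_card_survivors_le {α X η : Type*} [DecidableEq α] [Fintype X] [Nonempty X]
    (S : Finset α) (H : Finset η) (kill : α → X → η → Prop)
    [∀ a x h, Decidable (kill a x h)] (ε : ℝ) (hε : ε ≤ 1)
    (hkill : ∀ a ∈ S, ∀ h ∈ H, ε * Fintype.card X ≤ #{x | kill a x h}) :
    ∃ f : α → X, (#{h ∈ H | ∀ a ∈ S, ¬ kill a (f a) h} : ℝ) ≤ (1 - ε) ^ #S * #H := by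
  induction S using Finset.induction_on with
  | empty => exact ⟨fun _ => Classical.arbitrary X, by simp⟩
  | insert a S ha ih =>
    obtain ⟨f, hf⟩ := ih fun b hb => hkill b (mem_insert_of_mem hb)
    set K := {h ∈ H | ∀ a ∈ S, ¬ kill a (f a) h} with hK
    have hsum : ∑ x : X, (#{h ∈ K | ¬ kill a x h} : ℝ) ≤ ∑ _x : X, (1 - ε) * #K := by
      simp only [card_filter, Nat.cast_sum]
      rw [sum_comm, sum_const, card_univ, nsmul_eq_mul, ← mul_assoc, mul_comm _ (#K : ℝ),
        ← nsmul_eq_mul, ← sum_const]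
      refine sum_le_sum fun h hh => ?_
      rw [← Nat.cast_sum, ← card_filter]
      have h1 := hkill a (mem_insert_self _ _) h (mem_filter.1 hh).1
      have h2 : (#{x | kill a x h} : ℝ) + #{x | ¬ kill a x h} = Fintype.card X := by
        exact_mod_cast card_filter_add_card_filter_not _
      linarith
    -- Some choice at `a` does at least as well as the average on the survivors `K`.
    obtain ⟨x, -, hx⟩ := exists_le_of_sum_le univ_nonempty hsum
    refine ⟨Function.update f a x, ?_⟩
    have hS : ∀ b ∈ S, Function.update f a x b = f b := fun b hb =>
      Function.update_of_ne (by rintro rfl; exact ha hb) _ _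
    have hset : {h ∈ H | ∀ b ∈ insert a S, ¬ kill b (Function.update f a x b) h} =
        {h ∈ K | ¬ kill a x h} := by
      ext h
      simp only [mem_filter, forall_mem_insert, Function.update_self, hK, and_assoc]
      refine and_congr_right fun _ => ?_
      rw [and_comm]
      refine and_congr_left fun _ => forall₂_congr fun b hb => by rw [hS b hb]
    rw [hset, card_insert_of_notMem ha, pow_succ, mul_right_comm]
    calc _ ≤ (1 - ε) * #K := hx
      _ ≤ (1 - ε) * ((1 - ε) ^ #S * #H) := mul_le_mul_of_nonneg_left hf (by linarith)
      _ = _ := by ring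

/-! ### Lists admitting no proper colouring -/

/-- A set of colours meeting every `k`-subset of a `2 * k`-set has at least `k` elements. -/
theorem le_card_of_forall_meets {k : ℕ} (C : Finset (Fin (2 * k)))
    (h : ∀ S ∈ powersetCard k (univ : Finset (Fin (2 * k))), ∃ j ∈ S, j ∈ C) : k ≤ #C := by
  by_contra! hC
  have hcompl : k ≤ #Cᶜ := by rw [card_compl, Fintype.card_fin]; omega
  obtain ⟨S, hSC, hS⟩ := exists_subset_card_eq hcompl
  obtain ⟨j, hjS, hjC⟩ := h S (mem_powersetCard.2 ⟨subset_univ _, hS⟩)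
  exact mem_compl.1 (hSC hjS) hjC

theorem not_separationChoosable_of_embedding {V κ : Type*} (G : SimpleGraph V) (k : ℕ)
    (e : κ ↪ ℕ+) [DecidableEq κ] (L : V → Finset κ) (hcard : ∀ v, #(L v) = k)
    (hsep : ∀ u v, G.Adj u v → #(L u ∩ L v) ≤ 1)
    (hcol : ∀ c : V → κ, (∀ v, c v ∈ L v) → ∃ u v, G.Adj u v ∧ c u = c v) :
    ¬ SeparationChoosable G k := by
  intro hch
  obtain ⟨c, hc⟩ := hch (fun v => (L v).map e) (fun v => by rw [card_map, hcard])
    (fun u v huv => by rw [← map_inter, card_map]; exact hsep u v huv)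
  choose c' hc' hcc' using fun v => mem_map.1 (hc v)
  obtain ⟨u, v, huv, hEq⟩ := hcol c' hc'
  exact c.valid huv (by rw [← hcc', ← hcc', hEq])

/-- A first label is a block with a `k`-subset of it, at most `k * 4 ^ k` in all; the second, with
`8 * k * 2 ^ k` values, thins `B` to `B'`. -/
theorem not_separationChoosable {V : Type*} [Fintype V] (G : SimpleGraph V)
    [DecidableRel G.Adj] (A B : Finset V) (hdisj : Disjoint A B)
    (hG : ∀ u v, G.Adj u v → (u ∈ A ∧ v ∈ B) ∨ (u ∈ B ∧ v ∈ A)) (hBA : #B ≤ #A)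
    (hA : A.Nonempty) (d k : ℕ) (hk : 0 < k) (hdeg : ∀ a ∈ A, d ≤ G.degree a)
    (hd : 4 * (k * 4 ^ k) ^ 2 * (8 * k * 2 ^ k) ≤ d) : ¬ SeparationChoosable G k := by
  classical
  set P := powersetCard k (univ : Finset (Fin (2 * k))) with hP
  have : Nonempty (Fin k) := ⟨⟨0, hk⟩⟩
  have : Nonempty (Fin (2 * k)) := ⟨⟨0, by omega⟩⟩
  have : Nonempty P := by
    obtain ⟨S, hS⟩ := powersetCard_nonempty.2
      (show k ≤ #(univ : Finset (Fin (2 * k))) by rw [card_univ, Fintype.card_fin]; omega)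
    exact ⟨⟨S, hS⟩⟩
  have hτ : Fintype.card (Fin k × P) ≤ k * 4 ^ k := by
    rw [Fintype.card_prod, Fintype.card_fin, Fintype.card_coe, hP, card_powersetCard, card_univ,
      Fintype.card_fin]
    refine Nat.mul_le_mul_left _ ((Nat.choose_le_two_pow _ _).trans_eq ?_)
    rw [pow_mul]; norm_num
  have hNpos : 0 < 8 * k * 2 ^ k := by positivity
  obtain ⟨φ, hfew, hmany⟩ := exists_labelling (τ := Fin k × P) (σ := Fin (8 * k * 2 ^ k))
    ⟨0, hNpos⟩ A B hBA (fun a => G.neighborFinset a) d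
    (fun a ha => by rw [G.card_neighborFinset_eq_degree]; exact hdeg a ha)
    (le_trans (by rw [Fintype.card_fin]; gcongr) hd)
  rw [Fintype.card_fin] at hfew
  set o : Fin (8 * k * 2 ^ k) := ⟨0, hNpos⟩
  set B' := {b ∈ B | (φ b).2 = o} with hB'
  set S := {a ∈ A | ∀ t, ∃ b ∈ G.neighborFinset a, φ b = (t, o)} with hS
  let LB : V → Finset (Fin k × Fin (2 * k)) := fun b => {(φ b).1.1} ×ˢ ((φ b).1.2 : Finset _)
  have hLB : ∀ b, #(LB b) = k := fun b => by
    rw [card_product, card_singleton, one_mul, (mem_powersetCard.1 (φ b).1.2.2).2]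
  -- Fixing the value off `B'` makes `H` count exactly the colourings of `B'`.
  let z : Fin k × Fin (2 * k) := Classical.arbitrary _
  let H : Finset (V → Fin k × Fin (2 * k)) :=
    Fintype.piFinset fun v => if v ∈ B' then LB v else {z}
  have hH : #H = k ^ #B' := by
    rw [Fintype.card_piFinset, ← prod_const,
      ← prod_subset (subset_univ B') (fun v _ hv => by simp [hv])]
    exact prod_congr rfl fun v hv => by rw [if_pos hv, hLB]
  have hnbr : ∀ a ∈ A, ∀ b, G.Adj a b → b ∈ B := by
    intro a ha b hab
    rcases hG a b hab with h | h
    · exact h.2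
    · exact absurd h.1 (disjoint_left.1 hdisj ha)
  -- A kill means that active neighbours use up the whole list of `a`; at least `k ^ k` of the `(2 *
  -- k) ^ k` lists are killed.
  obtain ⟨f, hf⟩ := exists_choice_card_survivors_le (X := Fin k → Fin (2 * k)) S H
    (fun a x h => ∀ i, ∃ b ∈ B', G.Adj a b ∧ h b = (i, x i)) ((1 / 2) ^ k)
    (pow_le_one₀ (by norm_num) (by norm_num)) (by
      intro a ha h hh
      set C : Fin k → Finset (Fin (2 * k)) := fun i => {j | ∃ b ∈ B', G.Adj a b ∧ h b = (i, j)}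
      have hset : ({x : Fin k → Fin (2 * k) | ∀ i, ∃ b ∈ B', G.Adj a b ∧ h b = (i, x i)}
          : Finset _) = Fintype.piFinset C := by
        ext x; simp [C]
      have hC : ∀ i, k ≤ #(C i) := by
        intro i
        refine le_card_of_forall_meets _ fun Q hQ => ?_
        obtain ⟨haA, haS⟩ := mem_filter.1 ha
        obtain ⟨b, hb, hφ⟩ := haS (i, ⟨Q, hQ⟩)
        rw [SimpleGraph.mem_neighborFinset] at hb
        have hbB : b ∈ B' := mem_filter.2 ⟨hnbr a haA b hb, by rw [hφ]⟩
        have hhb := Fintype.mem_piFinset.1 hh b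
        rw [if_pos hbB] at hhb
        simp only [LB, hφ, mem_product, mem_singleton] at hhb
        exact ⟨(h b).2, hhb.2, mem_filter.2 ⟨mem_univ _, b, hbB, hb, by rw [← hhb.1]⟩⟩
      have hge : k ^ k ≤ ∏ i, #(C i) := by
        calc k ^ k = ∏ _i : Fin k, k := by simp
          _ ≤ _ := prod_le_prod' fun i _ => hC i
      rw [hset, Fintype.card_piFinset, Fintype.card_fun, Fintype.card_fin, Fintype.card_fin]
      calc ((1 / 2 : ℝ) ^ k * ((2 * k) ^ k : ℕ)) = ((k ^ k : ℕ) : ℝ) := by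
            push_cast; rw [← mul_pow]; congr 1; ring
        _ ≤ _ := by exact_mod_cast hge)
  have hnone : ∀ h ∈ H, ∃ a ∈ S, ∀ i, ∃ b ∈ B', G.Adj a b ∧ h b = (i, f a i) := by
    by_contra! hex
    obtain ⟨h, hh, hsurv⟩ := hex
    have hApos : 0 < (#A : ℝ) := by exact_mod_cast hA.card_pos
    have hkpos : 0 < (k : ℝ) := by exact_mod_cast hk
    set ε : ℝ := (1 / 2) ^ k with hε
    have hεpos : 0 < ε := by positivity
    have hε1 : ε ≤ 1 := pow_le_one₀ (by norm_num) (by norm_num)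
    have hε2 : ε * 2 ^ k = 1 := by rw [hε, ← mul_pow]; norm_num
    have h1 : (1 - ε) ^ #S ≤ Real.exp (-(ε * #S)) := by
      calc _ ≤ Real.exp (-ε) ^ #S :=
            pow_le_pow_left₀ (by linarith) (by linarith [Real.add_one_le_exp (-ε)]) _
        _ = _ := by rw [← Real.exp_nat_mul]; congr 1; ring
    have h2 : ((#H : ℕ) : ℝ) ≤ Real.exp (k * #B') := by
      rw [hH]; push_cast
      calc _ ≤ Real.exp k ^ #B' :=
            pow_le_pow_left₀ hkpos.le (by linarith [Real.add_one_le_exp (k : ℝ)]) _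
        _ = _ := by rw [← Real.exp_nat_mul]; congr 1; ring
    have h3 : (1 : ℝ) ≤ Real.exp (-(ε * #S) + k * #B') := by
      rw [Real.exp_add]
      refine (hf.trans (mul_le_mul h1 h2 (by positivity) (by positivity))).trans'
        (Nat.one_le_cast.2 (card_pos.2 ⟨h, (@mem_filter _ _ (_) _ _).2 ⟨hh, fun a ha hcon => ?_⟩⟩))
      obtain ⟨i, hi⟩ := hsurv a ha
      obtain ⟨b, hb, hab, hEq⟩ := hcon i
      exact hi b hb hab hEq
    -- A survivor forces `ε * #S ≤ k * #B'`, but `k * #B' ≤ ε * #A / 4` and `ε * #S ≥ ε * #A / 2`.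
    have h4 : 0 ≤ -(ε * #S) + k * #B' := Real.one_le_exp_iff.1 h3
    push_cast at hfew
    have h5 : ε * (8 * k * 2 ^ k * #B') ≤ ε * (2 * #A) := mul_le_mul_of_nonneg_left hfew hεpos.le
    have h6 : ε * (8 * k * 2 ^ k * #B') = 8 * (k * #B') := by
      linear_combination (8 * k * #B' : ℝ) * hε2
    have h7 : ε * #A ≤ ε * (2 * #S) := mul_le_mul_of_nonneg_left hmany hεpos.le
    have h8 : 0 < ε * #A := by positivity
    linarith
  let LA : V → Finset (Fin k × Fin (2 * k)) := fun a =>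
    univ.image fun i => (i, f a i)
  have hsep : ∀ a b, #(LA a ∩ LB b) ≤ 1 := by
    intro a b
    refine card_le_one.2 fun p hp q hq => ?_
    simp only [LA, LB, mem_inter, mem_image, mem_univ, true_and, mem_product,
      mem_singleton] at hp hq
    obtain ⟨⟨i, rfl⟩, hi, -⟩ := hp
    obtain ⟨⟨j, rfl⟩, hj, -⟩ := hq
    simp only at hi hj
    rw [hi, hj]
  obtain ⟨e⟩ : Nonempty (Fin k × Fin (2 * k) ↪ ℕ+) :=
    ⟨⟨fun p => Nat.succPNat (Encodable.encode p), fun p q h =>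
      Encodable.encode_injective (Nat.succPNat_injective h)⟩⟩
  refine not_separationChoosable_of_embedding G k e (fun v => if v ∈ A then LA v else LB v)
    (fun v => ?_) (fun u v huv => ?_) (fun c hc => ?_)
  · split_ifs
    · rw [card_image_of_injective _ fun i j h => (Prod.ext_iff.1 h).1, card_univ, Fintype.card_fin]
    · exact hLB v
  · rcases hG u v huv with ⟨hu, hv⟩ | ⟨hu, hv⟩
    · rw [if_pos hu, if_neg (disjoint_right.1 hdisj hv)]
      exact hsep u v
    · rw [if_neg (disjoint_right.1 hdisj hu), if_pos hv, inter_comm]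
      exact hsep v u
  · obtain ⟨a, ha, hstuck⟩ := hnone (fun v => if v ∈ B' then c v else z)
      (Fintype.mem_piFinset.2 fun v => by
        by_cases hv : v ∈ B'
        · have := hc v
          rw [if_neg (disjoint_right.1 hdisj (mem_filter.1 hv).1)] at this
          simpa only [hv, if_true] using this
        · simp [hv])
    have hca := hc a
    rw [if_pos (mem_filter.1 ha).1] at hca
    obtain ⟨i, -, hi⟩ := mem_image.1 hca
    obtain ⟨b, hb, hab, hEq⟩ := hstuck i
    rw [if_pos hb] at hEq
    exact ⟨a, b, hab, by rw [hEq, ← hi]⟩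

/-! ### The logarithmic bound -/

theorem le_of_exp_le {d k : ℕ} (hk : 0 < k) (hd : Real.exp (13 * k) ≤ d) :
    4 * (k * 4 ^ k) ^ 2 * (8 * k * 2 ^ k) ≤ d := by
  have h2 : (2 : ℝ) ≤ Real.exp 1 := by linarith [Real.add_one_le_exp (1 : ℝ)]
  have hk1 : (1 : ℝ) ≤ k := by exact_mod_cast hk
  have hkE : (k : ℝ) ≤ Real.exp k := by linarith [Real.add_one_le_exp (k : ℝ)]
  have hE2 : (2 : ℝ) ≤ Real.exp k := h2.trans (Real.exp_le_exp.2 hk1)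
  have h2k : (2 : ℝ) ^ k ≤ Real.exp k := by
    calc (2 : ℝ) ^ k ≤ Real.exp 1 ^ k := pow_le_pow_left₀ (by norm_num) h2 _
      _ = Real.exp k := by rw [← Real.exp_nat_mul, mul_one]
  have h4 : (4 : ℝ) ^ k = (2 ^ k) ^ 2 := by rw [← pow_mul, mul_comm, pow_mul]; norm_num
  have h : ((4 * (k * 4 ^ k) ^ 2 * (8 * k * 2 ^ k) : ℕ) : ℝ) ≤ d := by
    calc ((4 * (k * 4 ^ k) ^ 2 * (8 * k * 2 ^ k) : ℕ) : ℝ)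
        = 2 ^ 5 * (k : ℝ) ^ 3 * (2 ^ k) ^ 5 := by push_cast; rw [h4]; ring
      -- Each of the `5 + 3 + 5 = 13` factors `2`, `k`, `2 ^ k` is at most `exp k`.
      _ ≤ Real.exp k ^ 5 * Real.exp k ^ 3 * Real.exp k ^ 5 := by gcongr
      _ = Real.exp (13 * k) := by
        rw [← pow_add, ← pow_add, ← Real.exp_nat_mul]; norm_num
      _ ≤ d := hd
  exact_mod_cast h

end SepChoose

theorem theorem2 :
    ∃ C : ℝ, 0 < C ∧
      ∀ (V : Type*) [Fintype V] (G : SimpleGraph V) [DecidableRel G.Adj] (d : ℕ),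
        G.IsBipartite → 1 ≤ d → G.minDegree = d →
          C * Real.log (d : ℝ) ≤ (SepChoose.sepChoosability G : ℝ) := by
  refine ⟨1 / 13, by norm_num, fun V _ G _ d hG hd hmin => ?_⟩
  classical
  obtain ⟨hpos, hch⟩ := Nat.sInf_mem (SepChoose.exists_separationChoosable G)
  change 0 < SepChoose.sepChoosability G at hpos
  change SepChoose.SeparationChoosable G (SepChoose.sepChoosability G) at hch
  set k := SepChoose.sepChoosability G
  by_contra! hlt
  have hexp : Real.exp (13 * k) ≤ d := by
    rw [← Real.exp_log (show (0 : ℝ) < d by exact_mod_cast hd)]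
    exact Real.exp_le_exp.2 (by linarith)
  have hdeg : ∀ v, d ≤ G.degree v := fun v => hmin ▸ G.minDegree_le_degree v
  have hne : Nonempty V := by
    by_contra hV
    rw [not_nonempty_iff] at hV
    rw [SimpleGraph.minDegree_of_subsingleton] at hmin
    omega
  obtain ⟨χ⟩ := hG
  let X : Fin 2 → Finset V := fun i => {v | χ v = i}
  -- The larger colour class plays `A`.
  have key : ∀ i j : Fin 2, i ≠ j → (X j).card ≤ (X i).card → False := by
    intro i j hij hcard
    have hX : ∀ v, v ∈ X i ∨ v ∈ X j := fun v => by
      simp only [X, Finset.mem_filter, Finset.mem_univ, true_and]; omega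
    have hdisj : Disjoint (X i) (X j) := Finset.disjoint_left.2 fun v h1 h2 =>
      hij ((Finset.mem_filter.1 h1).2.symm.trans (Finset.mem_filter.1 h2).2)
    refine SepChoose.not_separationChoosable G (X i) (X j) hdisj (fun u v huv => ?_) hcard ?_ d k
      hpos (fun a _ => hdeg a) (SepChoose.le_of_exp_le hpos hexp) hch
    · have := χ.valid huv
      simp only [X, Finset.mem_filter, Finset.mem_univ, true_and]
      omega
    · rw [Finset.nonempty_iff_ne_empty]
      intro h0
      obtain ⟨v⟩ := hne
      rw [h0, Finset.card_empty, Nat.le_zero, Finset.card_eq_zero] at hcard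
      simpa [h0, hcard] using hX v
  rcases le_total (X 1).card (X 0).card with h | h
  · exact key 0 1 (by decide) h
  · exact key 1 0 (by decide) h
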